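/- Let $r\ge 1$ be an integer. For a vector $\alpha\in\mathbb R^k$ let $D^{(1)}\alpha:=(\alpha_2-\alpha_1,\dots,\alpha_k-\alpha_{k-1})\in\mathbb R^{k-1}$, let $D^{(0)}\theta:=\theta$ and $D^{(j+1)}\theta:=D^{(1)}(D^{(j)}\theta)$. There is a constant $C_r>0$, depending on $r$ alone, such that the following holds for every integer $n\ge 2r$, every $\sigma\ge 0$ and every $\theta^*\in\mathbb R^n$ with $D^{(r)}\theta^*=0$. Let $Y=\theta^*+\xi$ with $\xi\sim N_n(0,\sigma^2I_n)$ and, for $\lambda\ge 0$, let $$\hat\theta^{(r)}_\lambda:=\operatorname*{argmin}_{\theta\in\mathbb R^n}\Big(\tfrac12\|Y-\theta\|^2+\sigma n^{r-1}\lambda\,\|D^{(r)}\theta\|_1\Big)$$ be the (unique) penalized trend filtering estimator of order $r$, where $\|\cdot\|$ is the Euclidean norm and $\|\cdot\|_1$ the $\ell^1$ norm. Then for every $\lambda\ge\sqrt{6n\log(en)}$ the loss $\|\hat\theta^{(r)}_\lambda-\theta^*\|^2$ is integrable and $$R(\hat\theta^{(r)}_\lambda,\theta^*):=\frac1n\,\mathbb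 E\,\big\|\hat\theta^{(r)}_\lambda-\theta^*\big\|^2\le\frac{C_r\sigma^2}{n}.$$ -/

import Mathlib

open MeasureTheory ProbabilityTheory

namespace TrendFilter

/-- The first difference `(α₂ - α₁, …, α_k - α_{k-1})` of a vector `α` of length `k`
(the empty vector if `k ≤ 1`). -/
def firstDiff {k : ℕ} (α : Fin k → ℝ) : Fin (k - 1) → ℝ :=
  fun i => α ⟨(i : ℕ) + 1, by omega⟩ - α ⟨(i : ℕ), by omega⟩

/-- The `r`-th order difference `D^{(r)} θ`, a vector of length `n - r`:
`D^{(0)} θ = θ` and `D^{(r+1)} θ = D^{(1)} (D^{(r)} θ)`. -/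
def diffOp : (r : ℕ) → {n : ℕ} → (Fin n → ℝ) → (Fin (n - r) → ℝ)
  | 0, _, θ => θ
  | r + 1, _, θ => firstDiff (diffOp r θ)

/-- The `ℓ¹` norm of a finite real vector. -/
def l1norm {k : ℕ} (x : Fin k → ℝ) : ℝ := ∑ i, |x i|

/-- The penalized least squares criterion
`½ ‖y - θ‖² + σ n^{r-1} lam ‖D^{(r)} θ‖₁`, with `‖·‖` the Euclidean norm (used for `r ≥ 1`). -/
noncomputable def objective (r n : ℕ) (σ lam : ℝ) (y θ : EuclideanSpace ℝ (Fin n)) : ℝ :=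
  (1 / 2) * ‖y - θ‖ ^ 2 + σ * (n : ℝ) ^ (r - 1) * lam * l1norm (diffOp r θ.ofLp)

/-- The penalized trend filtering estimator of order `r`: the minimizer over `ℝⁿ` of the
penalized criterion. For `σ, lam ≥ 0` it exists and is unique, see `estimator_isMinOn` and
`eq_estimator_of_isMinOn` below. -/
noncomputable def estimator (r n : ℕ) (σ lam : ℝ) (y : EuclideanSpace ℝ (Fin n)) :
    EuclideanSpace ℝ (Fin n) :=
  Classical.epsilon fun θ => IsMinOn (objective r n σ lam y) Set.univ θ

/-- The law `N_n(θstar, σ² I_n)` of the observation vector `Y = θstar + ξ`. -/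
noncomputable def obsLaw (n : ℕ) (σ : ℝ) (θstar : EuclideanSpace ℝ (Fin n)) :
    Measure (EuclideanSpace ℝ (Fin n)) :=
  multivariateGaussian θstar (σ ^ 2 • (1 : Matrix (Fin n) (Fin n) ℝ))

/-- The squared error loss `‖est(y) - θstar‖²` as a function of the data. -/
noncomputable def sqLoss {n : ℕ} (est : EuclideanSpace ℝ (Fin n) → EuclideanSpace ℝ (Fin n))
    (θstar : EuclideanSpace ℝ (Fin n)) (y : EuclideanSpace ℝ (Fin n)) : ℝ :=
  ‖est y - θstar‖ ^ 2

/-- The risk `R(est, θstar) = (1/n) E ‖est(Y) - θstar‖²` for `Y ∼ N_n(θstar, σ² I_n)`. -/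
noncomputable def risk {n : ℕ} (σ : ℝ)
    (est : EuclideanSpace ℝ (Fin n) → EuclideanSpace ℝ (Fin n))
    (θstar : EuclideanSpace ℝ (Fin n)) : ℝ :=
  (1 / (n : ℝ)) * ∫ y, sqLoss est θstar y ∂(obsLaw n σ θstar)

/-! Existence and uniqueness of the minimizer. -/

theorem diffOp_add (r : ℕ) {n : ℕ} (θ η : Fin n → ℝ) :
    diffOp r (θ + η) = diffOp r θ + diffOp r η := by
  induction r with
  | zero => rfl
  | succ r ih =>
    change firstDiff (diffOp r (θ + η)) = firstDiff (diffOp r θ) + firstDiff (diffOp r η)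
    rw [ih]
    funext i
    simp only [firstDiff, Pi.add_apply]
    ring

theorem diffOp_smul (r : ℕ) {n : ℕ} (c : ℝ) (θ : Fin n → ℝ) :
    diffOp r (c • θ) = c • diffOp r θ := by
  induction r with
  | zero => rfl
  | succ r ih =>
    change firstDiff (diffOp r (c • θ)) = c • firstDiff (diffOp r θ)
    rw [ih]
    funext i
    simp only [firstDiff, Pi.smul_apply, smul_eq_mul]
    ring

theorem continuous_diffOp (r : ℕ) {n : ℕ} :
    Continuous (fun θ : Fin n → ℝ => diffOp r θ) := by
  induction r with
  | zero => exact continuous_id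
  | succ r ih =>
    refine continuous_pi fun i => ?_
    exact ((continuous_apply _).comp ih).sub ((continuous_apply _).comp ih)

theorem l1norm_nonneg {k : ℕ} (x : Fin k → ℝ) : 0 ≤ l1norm x :=
  Finset.sum_nonneg fun _ _ => abs_nonneg _

theorem exists_isMinOn (r n : ℕ) {σ lam : ℝ} (hσ : 0 ≤ σ) (hlam : 0 ≤ lam)
    (y : EuclideanSpace ℝ (Fin n)) :
    ∃ θ, IsMinOn (objective r n σ lam y) Set.univ θ := by
  have hcont : Continuous (objective r n σ lam y) := by
    have h1 : Continuous fun θ : EuclideanSpace ℝ (Fin n) => l1norm (diffOp r θ.ofLp) := by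
      have h2 : Continuous fun θ : EuclideanSpace ℝ (Fin n) => diffOp r θ.ofLp :=
        (continuous_diffOp r).comp (PiLp.continuous_ofLp 2 _)
      exact continuous_finsetSum _ fun i _ => ((continuous_apply i).comp h2).abs
    unfold objective
    fun_prop
  have hlim : Filter.Tendsto (objective r n σ lam y)
      (Filter.cocompact (EuclideanSpace ℝ (Fin n))) Filter.atTop := by
    have h1 : Filter.Tendsto (fun θ : EuclideanSpace ℝ (Fin n) => ‖y - θ‖)
        (Filter.cocompact _) Filter.atTop :=
      (tendsto_norm_cocompact_atTop).comp
        (Homeomorph.subLeft y).isClosedEmbedding.tendsto_cocompact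
    have h2 := ((Filter.tendsto_pow_atTop (α := ℝ) two_ne_zero).comp h1).const_mul_atTop
      (show (0 : ℝ) < 1 / 2 by norm_num)
    refine Filter.tendsto_atTop_mono (fun θ => ?_) h2
    have : 0 ≤ σ * (n : ℝ) ^ (r - 1) * lam * l1norm (diffOp r θ.ofLp) :=
      mul_nonneg (by positivity) (l1norm_nonneg _)
    simpa [objective] using this
  obtain ⟨θ, hθ⟩ := hcont.exists_forall_le hlim
  exact ⟨θ, fun η _ => hθ η⟩

/-- The estimator is a minimizer of the penalized criterion. -/
theorem estimator_isMinOn (r n : ℕ) {σ lam : ℝ} (hσ : 0 ≤ σ) (hlam : 0 ≤ lam)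
    (y : EuclideanSpace ℝ (Fin n)) :
    IsMinOn (objective r n σ lam y) Set.univ (estimator r n σ lam y) :=
  Classical.epsilon_spec (exists_isMinOn r n hσ hlam y)

/-- The estimator is the only minimizer of the penalized criterion. -/
theorem eq_estimator_of_isMinOn (r n : ℕ) {σ lam : ℝ} (hσ : 0 ≤ σ) (hlam : 0 ≤ lam)
    (y θ : EuclideanSpace ℝ (Fin n)) (hθ : IsMinOn (objective r n σ lam y) Set.univ θ) :
    θ = estimator r n σ lam y := by
  have hη := estimator_isMinOn r n hσ hlam y
  set η := estimator r n σ lam y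
  have h1 := hθ (Set.mem_univ ((1 / 2 : ℝ) • (θ + η)))
  have h2 := hη (Set.mem_univ ((1 / 2 : ℝ) • (θ + η)))
  simp only [Set.mem_ofPred_eq] at h1 h2
  have hpar : ‖y - (1 / 2 : ℝ) • (θ + η)‖ ^ 2
      = (1 / 2) * ‖y - θ‖ ^ 2 + (1 / 2) * ‖y - η‖ ^ 2 - (1 / 4) * ‖θ - η‖ ^ 2 := by
    have e1 : y - (1 / 2 : ℝ) • (θ + η) = (1 / 2 : ℝ) • ((y - θ) + (y - η)) := by module
    have e2 : θ - η = (y - η) - (y - θ) := by abel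
    rw [e1, e2, norm_smul, mul_pow, norm_add_sq_real (y - θ), norm_sub_sq_real (y - η) (y - θ),
      real_inner_comm (y - θ) (y - η)]
    norm_num
    ring
  have hpen : l1norm (diffOp r ((1 / 2 : ℝ) • (θ + η)).ofLp)
      ≤ (1 / 2) * l1norm (diffOp r θ.ofLp) + (1 / 2) * l1norm (diffOp r η.ofLp) := by
    have e : diffOp r ((1 / 2 : ℝ) • (θ + η)).ofLp
        = (1 / 2 : ℝ) • (diffOp r θ.ofLp + diffOp r η.ofLp) := by
      rw [← diffOp_add, ← diffOp_smul]
      rfl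
    rw [e]
    simp only [l1norm, Finset.mul_sum, ← Finset.sum_add_distrib]
    refine Finset.sum_le_sum fun i _ => ?_
    have : |((1 / 2 : ℝ) • (diffOp r θ.ofLp + diffOp r η.ofLp)) i|
        = (1 / 2) * |diffOp r θ.ofLp i + diffOp r η.ofLp i| := by
      simp [abs_mul]
    rw [this]
    linarith [abs_add_le (diffOp r θ.ofLp i) (diffOp r η.ofLp i)]
  have hc : 0 ≤ σ * (n : ℝ) ^ (r - 1) * lam := by positivity
  have hpen' := mul_le_mul_of_nonneg_left hpen hc
  unfold objective at h1 h2
  have hsq : ‖θ - η‖ ^ 2 ≤ 0 := by nlinarith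
  have h0 : ‖θ - η‖ = 0 := by
    have := sq_nonneg ‖θ - η‖
    exact pow_eq_zero_iff two_ne_zero |>.1 (le_antisymm hsq this)
  exact sub_eq_zero.1 (norm_eq_zero.1 h0)

end TrendFilter

/-! Write `K` for the kernel of `D^{(r)}`, `P` for the orthogonal projection onto it and `ξ` for the
noise. Since `θ* ∈ K`, two facts about the loss suffice.

Always, the loss is at most `‖ξ‖²`: the estimator is a proximal map, hence nonexpansive, and it
fixes `θ*` (`sqLoss_estimator_le`).

Usually, the loss is `‖Pξ‖²`. Iterated partial sums give preimages `a_j` of the unit vectors under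
`D^{(r)}` with `‖a_j‖ ≤ n^{r-1}√n`. If every `⟨(I-P)ξ, a_j⟩` is at most the penalty level in
absolute value, the estimator equals `PY` (`estimator_eq_starProjection`). Gaussian tails and a
union bound show that this fails with probability at most `n⁻²` (`exists_event_sqLoss_le`).

As `dim K = r`, the usual case costs `r` times the noise variance. On the exceptional event, `‖ξ‖²`
is split into fourth moments and a multiple of the event's probability, at total cost `O(σ²)`. -/

namespace TrendFilter

/-! ### A right inverse of the difference operator -/

/-- Partial sums invert the first difference. -/
theorem exists_firstDiff_eq {k : ℕ} (v : Fin (k - 1) → ℝ) :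
    ∃ x : Fin k → ℝ, firstDiff x = v ∧ ∀ i, |x i| ≤ l1norm v := by
  refine ⟨fun i => ∑ l ∈ Finset.univ.filter fun l : Fin (k - 1) => (l : ℕ) < i, v l, ?_, fun i => ?_⟩
  · funext i
    have h : (Finset.univ.filter fun l : Fin (k - 1) => (l : ℕ) < (i : ℕ) + 1)
        = insert i (Finset.univ.filter fun l : Fin (k - 1) => (l : ℕ) < i) := by
      ext l
      simp only [Finset.mem_filter, Finset.mem_univ, true_and, Finset.mem_insert, Fin.ext_iff]
      omega
    simp only [firstDiff, h]
    rw [Finset.sum_insert (by simp), add_sub_cancel_right]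
  · exact (Finset.abs_sum_le_sum_abs _ _).trans
      (Finset.sum_le_sum_of_subset_of_nonneg (Finset.filter_subset _ _) fun _ _ _ => abs_nonneg _)

/-- `D^{(r+1)}` is onto, with preimages controlled in sup norm. -/
theorem exists_diffOp_succ_eq (r : ℕ) {n : ℕ} (v : Fin (n - (r + 1)) → ℝ) :
    ∃ x : Fin n → ℝ, diffOp (r + 1) x = v ∧ ∀ i, |x i| ≤ (n : ℝ) ^ r * l1norm v := by
  induction r with
  | zero =>
    obtain ⟨x, hx, hb⟩ := exists_firstDiff_eq (k := n) v
    exact ⟨x, hx, by simpa using hb⟩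
  | succ r ih =>
    obtain ⟨w, hw, hwb⟩ := exists_firstDiff_eq (k := n - (r + 1)) v
    obtain ⟨x, hx, hxb⟩ := ih w
    refine ⟨x, ?_, fun i => (hxb i).trans ?_⟩
    · change firstDiff (diffOp (r + 1) x) = v
      rw [hx, hw]
    -- The sup norm of a partial sum is at most the `ℓ¹` norm, so one summation is free; each
    -- further one costs a factor `n`, from passing back to `ℓ¹`.
    · have h1 : l1norm w ≤ n * l1norm v := by
        calc l1norm w ≤ ∑ _i : Fin (n - (r + 1)), l1norm v := Finset.sum_le_sum fun i _ => hwb i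
          _ = ((n - (r + 1) : ℕ) : ℝ) * l1norm v := by simp
          _ ≤ n * l1norm v :=
            mul_le_mul_of_nonneg_right (by exact_mod_cast Nat.sub_le _ _) (l1norm_nonneg v)
      rw [pow_succ, mul_assoc]
      gcongr

/-- The difference operator as a linear map on Euclidean space. -/
def diffMap (r n : ℕ) : EuclideanSpace ℝ (Fin n) →ₗ[ℝ] (Fin (n - r) → ℝ) where
  toFun θ := diffOp r θ.ofLp
  map_add' θ η := diffOp_add r θ.ofLp η.ofLp
  map_smul' c θ := diffOp_smul r c θ.ofLp

theorem diffMap_apply (r n : ℕ) (θ : EuclideanSpace ℝ (Fin n)) :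
    diffMap r n θ = diffOp r θ.ofLp := rfl

theorem l1norm_single {k : ℕ} (j : Fin k) : l1norm (Pi.single j (1 : ℝ)) = 1 := by
  rw [l1norm, Finset.sum_eq_single j] <;> simp +contextual

theorem exists_diffMap_eq_single {r n : ℕ} (hr : 1 ≤ r) (j : Fin (n - r)) :
    ∃ a : EuclideanSpace ℝ (Fin n),
      diffMap r n a = Pi.single j 1 ∧ ‖a‖ ≤ (n : ℝ) ^ (r - 1) * √n := by
  obtain ⟨s, rfl⟩ := Nat.exists_eq_add_of_le' hr
  obtain ⟨x, hx, hb⟩ := exists_diffOp_succ_eq s (Pi.single j (1 : ℝ))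
  refine ⟨WithLp.toLp 2 x, hx, ?_⟩
  rw [l1norm_single, mul_one] at hb
  rw [Nat.add_sub_cancel, EuclideanSpace.norm_eq]
  refine Real.sqrt_le_iff.2 ⟨by positivity, ?_⟩
  calc ∑ i, ‖x i‖ ^ 2 ≤ ∑ _i : Fin n, ((n : ℝ) ^ s) ^ 2 :=
        Finset.sum_le_sum fun i _ => by
          rw [Real.norm_eq_abs]
          exact pow_le_pow_left₀ (abs_nonneg _) (hb i) 2
    _ = ((n : ℝ) ^ s * √n) ^ 2 := by
        rw [mul_pow, Real.sq_sqrt (Nat.cast_nonneg n)]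
        simp [mul_comm]

theorem finrank_ker_diffMap {r n : ℕ} (hr : 1 ≤ r) (hn : r ≤ n) :
    Module.finrank ℝ (LinearMap.ker (diffMap r n)) = r := by
  have hsurj : LinearMap.range (diffMap r n) = ⊤ := by
    refine LinearMap.range_eq_top.2 fun v => ?_
    obtain ⟨s, rfl⟩ := Nat.exists_eq_add_of_le' hr
    obtain ⟨x, hx, -⟩ := exists_diffOp_succ_eq s v
    exact ⟨WithLp.toLp 2 x, hx⟩
  have h := LinearMap.finrank_range_add_finrank_ker (diffMap r n)
  rw [hsurj, finrank_top] at h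
  simp only [Module.finrank_fintype_fun_eq_card, Fintype.card_fin, finrank_euclideanSpace] at h
  omega

/-! ### Proximal operators -/

section Prox

variable {E : Type*} [NormedAddCommGroup E] [InnerProductSpace ℝ E]

/-- The variational inequality of a proximal point. -/
theorem inner_sub_le_of_isMinOn {g : E → ℝ} (hg : ConvexOn ℝ Set.univ g) {y θ : E}
    (h : IsMinOn (fun η => (1 / 2) * ‖y - η‖ ^ 2 + g η) Set.univ θ) (η : E) :
    inner ℝ (y - θ) (η - θ) ≤ g η - g θ := by
  by_contra! hlt
  set d := inner ℝ (y - θ) (η - θ) - (g η - g θ) with hd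
  have hd0 : 0 < d := by linarith
  -- A step of length `t` towards `η` gains `t * d` to first order and loses `t² ‖η - θ‖² / 2`. This
  -- `t` stays in `(0, 1]` and has `t ‖η - θ‖² < d`, so the gain wins.
  set t := d / (d + ‖η - θ‖ ^ 2) with ht
  have hden : 0 < d + ‖η - θ‖ ^ 2 := by positivity
  have ht0 : 0 < t := by positivity
  have ht1 : t ≤ 1 := by
    rw [ht, div_le_one hden]
    linarith [sq_nonneg ‖η - θ‖]
  have hte : t * (d + ‖η - θ‖ ^ 2) = d := by
    rw [ht]
    field_simp
  have h1 := h (Set.mem_univ (θ + t • (η - θ)))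
  simp only [Set.mem_ofPred_eq] at h1
  have h2 := hg.2 (Set.mem_univ θ) (Set.mem_univ η) (sub_nonneg.2 ht1) ht0.le (by ring)
  have e : (1 - t) • θ + t • η = θ + t • (η - θ) := by module
  rw [e, smul_eq_mul, smul_eq_mul] at h2
  have e2 : ‖y - (θ + t • (η - θ))‖ ^ 2
      = ‖y - θ‖ ^ 2 - 2 * (t * inner ℝ (y - θ) (η - θ)) + t ^ 2 * ‖η - θ‖ ^ 2 := by
    rw [← sub_sub, norm_sub_sq_real, inner_smul_right, norm_smul, mul_pow, Real.norm_eq_abs,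
      sq_abs]
  rw [e2] at h1
  have h3 : t * d ≤ t * (t * ‖η - θ‖ ^ 2 / 2) := by
    rw [hd]
    nlinarith
  have h4 := le_of_mul_le_mul_left h3 ht0
  nlinarith [mul_pos ht0 hd0]

/-- Proximal points depend on the base point in a nonexpansive way. -/
theorem norm_sub_le_of_isMinOn {g : E → ℝ} (hg : ConvexOn ℝ Set.univ g) {y y' θ θ' : E}
    (h : IsMinOn (fun η => (1 / 2) * ‖y - η‖ ^ 2 + g η) Set.univ θ)
    (h' : IsMinOn (fun η => (1 / 2) * ‖y' - η‖ ^ 2 + g η) Set.univ θ') :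
    ‖θ - θ'‖ ≤ ‖y - y'‖ := by
  have h1 := inner_sub_le_of_isMinOn hg h θ'
  have h2 := inner_sub_le_of_isMinOn hg h' θ
  -- Adding the two variational inequalities cancels `g`; Cauchy–Schwarz then finishes.
  have e : inner ℝ (y - θ) (θ' - θ) + inner ℝ (y' - θ') (θ - θ')
      = ‖θ - θ'‖ ^ 2 - inner ℝ (y - y') (θ - θ') := by
    rw [← real_inner_self_eq_norm_sq, ← neg_sub θ θ', inner_neg_right, neg_add_eq_sub,
      ← inner_sub_left, ← inner_sub_left]
    congr 1
    abel
  have h3 := real_inner_le_norm (y - y') (θ - θ')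
  by_contra! hlt
  nlinarith [norm_nonneg (y - y')]

end Prox

/-! ### Deterministic properties of the estimator -/

theorem l1norm_add_le {k : ℕ} (x y : Fin k → ℝ) : l1norm (x + y) ≤ l1norm x + l1norm y := by
  rw [l1norm, l1norm, l1norm, ← Finset.sum_add_distrib]
  exact Finset.sum_le_sum fun i _ => abs_add_le _ _

theorem l1norm_smul {k : ℕ} (c : ℝ) (x : Fin k → ℝ) : l1norm (c • x) = |c| * l1norm x := by
  simp [l1norm, abs_mul, Finset.mul_sum]

theorem convexOn_penalty (r n : ℕ) {c : ℝ} (hc : 0 ≤ c) :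
    ConvexOn ℝ Set.univ
      fun θ : EuclideanSpace ℝ (Fin n) => c * l1norm (diffOp r θ.ofLp) := by
  refine ⟨convex_univ, fun θ _ η _ a b ha hb _ => ?_⟩
  simp only [smul_eq_mul]
  rw [← diffMap_apply, ← diffMap_apply, ← diffMap_apply, map_add, map_smul, map_smul]
  have h := l1norm_add_le (a • diffMap r n θ) (b • diffMap r n η)
  rw [l1norm_smul, l1norm_smul, abs_of_nonneg ha, abs_of_nonneg hb] at h
  calc _ ≤ c * (a * l1norm (diffMap r n θ) + b * l1norm (diffMap r n η)) := by gcongr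
    _ = _ := by ring

theorem norm_estimator_sub_le (r n : ℕ) {σ lam : ℝ} (hσ : 0 ≤ σ) (hlam : 0 ≤ lam)
    (y z : EuclideanSpace ℝ (Fin n)) :
    ‖estimator r n σ lam y - estimator r n σ lam z‖ ≤ ‖y - z‖ :=
  norm_sub_le_of_isMinOn
    (convexOn_penalty r n (c := σ * (n : ℝ) ^ (r - 1) * lam) (by positivity))
    (estimator_isMinOn r n hσ hlam y) (estimator_isMinOn r n hσ hlam z)

theorem continuous_estimator (r n : ℕ) {σ lam : ℝ} (hσ : 0 ≤ σ) (hlam : 0 ≤ lam) :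
    Continuous (estimator r n σ lam) :=
  (LipschitzWith.of_dist_le_mul (K := 1) fun y z => by
    simpa [dist_eq_norm] using norm_estimator_sub_le r n hσ hlam y z).continuous

theorem estimator_eq_self (r n : ℕ) {σ lam : ℝ} (hσ : 0 ≤ σ) (hlam : 0 ≤ lam)
    {θ : EuclideanSpace ℝ (Fin n)} (hθ : diffOp r θ.ofLp = 0) :
    estimator r n σ lam θ = θ := by
  refine (eq_estimator_of_isMinOn r n hσ hlam θ θ fun η _ => ?_).symm
  have h : 0 ≤ σ * (n : ℝ) ^ (r - 1) * lam * l1norm (diffOp r η.ofLp) :=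
    mul_nonneg (by positivity) (l1norm_nonneg _)
  have h0 : l1norm (diffOp r θ.ofLp) = 0 := by simp [hθ, l1norm]
  simp only [Set.mem_ofPred_eq, objective, h0, sub_self, norm_zero]
  nlinarith [sq_nonneg ‖θ - η‖]

theorem sqLoss_estimator_le (r n : ℕ) {σ lam : ℝ} (hσ : 0 ≤ σ) (hlam : 0 ≤ lam)
    {θ : EuclideanSpace ℝ (Fin n)} (hθ : diffOp r θ.ofLp = 0) (y : EuclideanSpace ℝ (Fin n)) :
    sqLoss (estimator r n σ lam) θ y ≤ ‖y - θ‖ ^ 2 := by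
  have h := norm_estimator_sub_le r n hσ hlam y θ
  rw [estimator_eq_self r n hσ hlam hθ] at h
  exact pow_le_pow_left₀ (norm_nonneg _) h 2

/-- When the dual certificate is feasible, the estimator is the projection onto the kernel
of the difference operator. -/
theorem estimator_eq_starProjection (r n : ℕ) {σ lam : ℝ} (hσ : 0 ≤ σ) (hlam : 0 ≤ lam)
    {a : Fin (n - r) → EuclideanSpace ℝ (Fin n)}
    (ha : ∀ j, diffMap r n (a j) = Pi.single j 1) (y : EuclideanSpace ℝ (Fin n))
    (hy : ∀ j, |inner ℝ (y - (LinearMap.ker (diffMap r n)).starProjection y) (a j)|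
      ≤ σ * (n : ℝ) ^ (r - 1) * lam) :
    estimator r n σ lam y = (LinearMap.ker (diffMap r n)).starProjection y := by
  set K := LinearMap.ker (diffMap r n)
  set c := σ * (n : ℝ) ^ (r - 1) * lam with hc
  set p := K.starProjection y
  have hp : diffMap r n p = 0 := K.starProjection_apply_mem y
  refine (eq_estimator_of_isMinOn r n hσ hlam y p fun η _ => ?_).symm
  have h0 : l1norm (diffOp r p.ofLp) = 0 := by
    rw [← diffMap_apply, hp]
    simp [l1norm]
  simp only [Set.mem_ofPred_eq, objective, h0, ← hc, mul_zero, add_zero]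
  -- The residual `y - p` is orthogonal to `K`, so modulo `K` only the differences of `η` matter,
  -- and Hölder's inequality compares them with the penalty.
  have hmem : (η - p) - ∑ j, diffMap r n η j • a j ∈ K := by
    rw [LinearMap.mem_ker, map_sub, map_sub, hp, map_sum]
    ext i
    simp [ha, Pi.single_apply]
  have horth : inner ℝ (y - p) ((η - p) - ∑ j, diffMap r n η j • a j) = 0 :=
    K.starProjection_inner_eq_zero y _ hmem
  have hle : inner ℝ (y - p) (η - p) ≤ c * l1norm (diffOp r η.ofLp) := by
    rw [inner_sub_right, sub_eq_zero] at horth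
    rw [horth, inner_sum, l1norm, Finset.mul_sum, ← diffMap_apply]
    refine Finset.sum_le_sum fun j _ => ?_
    rw [inner_smul_right]
    calc _ ≤ |diffMap r n η j| * |inner ℝ (y - p) (a j)| := by
          rw [← abs_mul]
          exact le_abs_self _
      _ ≤ |diffMap r n η j| * c := by gcongr; exact hy j
      _ = _ := mul_comm _ _
  have e : ‖y - η‖ ^ 2 = ‖y - p‖ ^ 2 - 2 * inner ℝ (y - p) (η - p) + ‖η - p‖ ^ 2 := by
    rw [← norm_sub_sq_real, sub_sub_sub_cancel_right]
  rw [e]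
  nlinarith [sq_nonneg ‖η - p‖]

/-! ### Gaussian noise -/

instance isGaussian_obsLaw (n : ℕ) (σ : ℝ) (θ : EuclideanSpace ℝ (Fin n)) :
    IsGaussian (obsLaw n σ θ) := by
  unfold obsLaw
  infer_instance

/-- Linear functionals of the noise are scaled standard Gaussians. -/
theorem map_inner_obsLaw (n : ℕ) (σ : ℝ) (θ a : EuclideanSpace ℝ (Fin n)) :
    (obsLaw n σ θ).map (fun y => inner ℝ a (y - θ))
      = (gaussianReal 0 1).map fun z => σ * ‖a‖ * z := by
  have hpos : (σ ^ 2 • (1 : Matrix (Fin n) (Fin n) ℝ)).PosSemidef :=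
    Matrix.PosSemidef.one.smul (sq_nonneg σ)
  have hvar : Var[fun y => inner ℝ a y; obsLaw n σ θ] = (σ * ‖a‖) ^ 2 := by
    rw [← covarianceBilin_self IsGaussian.memLp_two_id, obsLaw,
      covarianceBilin_multivariateGaussian hpos, mul_pow, EuclideanSpace.real_norm_sq_eq]
    simp [Matrix.smul_mulVec, dotProduct, Finset.mul_sum, sq, mul_assoc, mul_left_comm]
  have hmean : ∫ y, inner ℝ a y ∂(obsLaw n σ θ) = inner ℝ a θ := by
    have h := (innerSL ℝ a).integral_comp_id_comm (μ := obsLaw n σ θ) IsGaussian.integrable_id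
    have hid : ∫ y, y ∂(obsLaw n σ θ) = θ := integral_id_multivariateGaussian
    rw [hid] at h
    simpa using h
  have hlaw : (obsLaw n σ θ).map (fun y => inner ℝ a y)
      = gaussianReal (inner ℝ a θ) ((σ * ‖a‖) ^ 2).toNNReal := by
    have h := IsGaussian.map_eq_gaussianReal (μ := obsLaw n σ θ) (innerSL ℝ a)
    have e : ⇑(innerSL ℝ a) = fun y => inner ℝ a y := by
      ext y
      simp
    rw [e] at h
    rw [h, hmean, hvar]
  have hcomp : (fun y => inner ℝ a (y - θ))
      = (fun x => x - inner ℝ a θ) ∘ fun y : EuclideanSpace ℝ (Fin n) => inner ℝ a y := by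
    ext y
    simp [inner_sub_right]
  rw [hcomp, ← Measure.map_map (by fun_prop) (by fun_prop), hlaw, gaussianReal_map_sub_const,
    gaussianReal_map_const_mul, sub_self, mul_zero, mul_one]
  congr 1
  ext
  simp [sq_nonneg]

theorem integrable_pow_gaussianReal (k : ℕ) :
    Integrable (fun z : ℝ => z ^ k) (gaussianReal 0 1) := by
  refine integrable_pow_of_mem_interior_integrableExpSet (X := id) ?_ k
  simp

theorem integrable_inner_pow (n : ℕ) (σ : ℝ) (θ a : EuclideanSpace ℝ (Fin n))
    (k : ℕ) : Integrable (fun y => inner ℝ a (y - θ) ^ k) (obsLaw n σ θ) := by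
  have h : Integrable (fun x : ℝ => x ^ k)
      ((obsLaw n σ θ).map (fun y => inner ℝ a (y - θ))) := by
    rw [map_inner_obsLaw n σ, integrable_map_measure (by fun_prop) (by fun_prop)]
    simp only [Function.comp_def, mul_pow]
    exact (integrable_pow_gaussianReal k).const_mul _
  exact h.comp_measurable (by fun_prop)

theorem integral_inner_pow (n : ℕ) (σ : ℝ) (θ a : EuclideanSpace ℝ (Fin n))
    (k : ℕ) : ∫ y, inner ℝ a (y - θ) ^ k ∂(obsLaw n σ θ)
      = (σ * ‖a‖) ^ k * ∫ z, z ^ k ∂(gaussianReal 0 1) := by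
  have h := integral_map (μ := obsLaw n σ θ) (φ := fun y => inner ℝ a (y - θ))
    (f := fun x : ℝ => x ^ k) (by fun_prop) (by fun_prop)
  rw [← h, map_inner_obsLaw n σ, integral_map (by fun_prop) (by fun_prop)]
  simp only [mul_pow]
  rw [integral_const_mul]

theorem gaussianReal_real_abs_gt_le {u : ℝ} (hu : 0 ≤ u) :
    (gaussianReal 0 1).real {z | u < |z|} ≤ 2 * Real.exp (-u ^ 2 / 2) := by
  have hsub : HasSubgaussianMGF (fun z : ℝ => z) 1 (gaussianReal 0 1) :=
    ⟨fun t => integrable_exp_mul_gaussianReal t, fun t => by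
      rw [mgf_fun_id_gaussianReal]
      simp⟩
  have h1 := hsub.measure_ge_le hu
  have h2 := hsub.neg.measure_ge_le hu
  simp only [NNReal.coe_one, mul_one, Pi.neg_apply] at h1 h2
  have h3 : {z : ℝ | u < |z|} ⊆ {z | u ≤ z} ∪ {z | u ≤ -z} := fun z hz => by
    rcases lt_abs.1 (show u < |z| from hz) with h | h
    · exact Or.inl h.le
    · exact Or.inr h.le
  calc _ ≤ (gaussianReal 0 1).real ({z | u ≤ z} ∪ {z | u ≤ -z}) := measureReal_mono h3
    _ ≤ _ := measureReal_union_le _ _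
    _ ≤ _ := by linarith

theorem obsLaw_real_abs_inner_gt_le (n : ℕ) {σ : ℝ} (hσ : 0 ≤ σ)
    (θ a : EuclideanSpace ℝ (Fin n)) {s u t : ℝ} (hs : ‖a‖ ≤ s) (hu : 0 ≤ u)
    (ht : σ * s * u ≤ t) :
    (obsLaw n σ θ).real {y | t < |inner ℝ a (y - θ)|} ≤ 2 * Real.exp (-u ^ 2 / 2) := by
  have hmeas : MeasurableSet {x : ℝ | t < |x|} := measurableSet_lt (by fun_prop) (by fun_prop)
  have e : (obsLaw n σ θ).real {y | t < |inner ℝ a (y - θ)|}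
      = (gaussianReal 0 1).real {z | t < |σ * ‖a‖ * z|} := by
    have h := congrArg (fun m => m.real {x : ℝ | t < |x|}) (map_inner_obsLaw n σ θ a)
    rwa [map_measureReal_apply (by fun_prop) hmeas,
      map_measureReal_apply (by fun_prop) hmeas] at h
  rw [e]
  refine (measureReal_mono fun z hz => ?_).trans (gaussianReal_real_abs_gt_le hu)
  by_contra hzu
  have hzu' : |z| ≤ u := not_lt.1 hzu
  refine absurd (show t < |σ * ‖a‖ * z| from hz) (not_lt.2 (le_trans ?_ ht))
  rw [abs_mul, abs_of_nonneg (by positivity : 0 ≤ σ * ‖a‖)]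
  have hs0 : 0 ≤ s := (norm_nonneg a).trans hs
  gcongr

theorem integrable_norm_sub_sq (n : ℕ) (σ : ℝ) (θ : EuclideanSpace ℝ (Fin n)) :
    Integrable (fun y => ‖y - θ‖ ^ 2) (obsLaw n σ θ) := by
  simp_rw [← (EuclideanSpace.basisFun (Fin n) ℝ).sum_sq_inner_right]
  exact integrable_finsetSum _ fun i _ => integrable_inner_pow n σ θ _ 2

theorem norm_starProjection_sq_eq {E : Type*} [NormedAddCommGroup E] [InnerProductSpace ℝ E]
    (K : Submodule ℝ E) [FiniteDimensional ℝ K] (x : E) :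
    ‖K.starProjection x‖ ^ 2
      = ∑ i, inner ℝ ((stdOrthonormalBasis ℝ K i : K) : E) x ^ 2 := by
  rw [K.starProjection_apply, ← Submodule.coe_norm,
    ← (stdOrthonormalBasis ℝ K).sum_sq_inner_right]
  simp

/-- In an orthonormal basis of `K`, each noise coordinate has the law of `σ` times a standard
Gaussian. -/
theorem integral_norm_starProjection_sq (n : ℕ) (σ : ℝ)
    (θ : EuclideanSpace ℝ (Fin n)) (K : Submodule ℝ (EuclideanSpace ℝ (Fin n))) :
    Integrable (fun y => ‖K.starProjection (y - θ)‖ ^ 2) (obsLaw n σ θ) ∧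
      ∫ y, ‖K.starProjection (y - θ)‖ ^ 2 ∂(obsLaw n σ θ)
        = Module.finrank ℝ K * (σ ^ 2 * ∫ z, z ^ 2 ∂(gaussianReal 0 1)) := by
  simp_rw [norm_starProjection_sq_eq]
  refine ⟨integrable_finsetSum _ fun i _ => integrable_inner_pow n σ θ _ 2, ?_⟩
  rw [integral_finsetSum _ fun i _ => integrable_inner_pow n σ θ _ 2]
  have hb : ∀ i, ‖(stdOrthonormalBasis ℝ K i : EuclideanSpace ℝ (Fin n))‖ = 1 := fun i => by
    rw [← Submodule.coe_norm]
    exact (stdOrthonormalBasis ℝ K).orthonormal.1 i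
  simp_rw [integral_inner_pow, hb, mul_one]
  rw [Finset.sum_const, Finset.card_univ, Fintype.card_fin, nsmul_eq_mul]

/-! ### Integrability and bounds for the loss -/

theorem integrable_sqLoss_estimator (r n : ℕ) {σ lam : ℝ} (hσ : 0 ≤ σ) (hlam : 0 ≤ lam)
    {θ : EuclideanSpace ℝ (Fin n)} (hθ : diffOp r θ.ofLp = 0) :
    Integrable (sqLoss (estimator r n σ lam) θ) (obsLaw n σ θ) := by
  have hcont : Continuous (sqLoss (estimator r n σ lam) θ) :=
    ((continuous_estimator r n hσ hlam).sub continuous_const).norm.pow 2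
  refine (integrable_norm_sub_sq n σ θ).mono' hcont.aestronglyMeasurable
    (Filter.Eventually.of_forall fun y => ?_)
  rw [Real.norm_of_nonneg (show 0 ≤ sqLoss _ _ _ from sq_nonneg _)]
  exact sqLoss_estimator_le r n hσ hlam hθ y

theorem integral_norm_sub_sq_zero (n : ℕ) (θ : EuclideanSpace ℝ (Fin n)) :
    ∫ y, ‖y - θ‖ ^ 2 ∂(obsLaw n 0 θ) = 0 := by
  simp_rw [← (EuclideanSpace.basisFun (Fin n) ℝ).sum_sq_inner_right]
  rw [integral_finsetSum _ fun i _ => integrable_inner_pow n 0 θ _ 2]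
  simp_rw [integral_inner_pow n 0]
  simp

/-- Off an event of polynomially small probability the loss is that of the projection onto
the kernel of the difference operator. -/
theorem exists_event_sqLoss_le {r n : ℕ} (hr : 1 ≤ r) (hn : 1 ≤ n) {σ lam : ℝ} (hσ : 0 ≤ σ)
    {θ : EuclideanSpace ℝ (Fin n)} (hθ : diffOp r θ.ofLp = 0)
    (hlam : √(6 * n * Real.log (Real.exp 1 * n)) ≤ lam) :
    ∃ B : Set (EuclideanSpace ℝ (Fin n)), MeasurableSet B ∧
      (n : ℝ) ^ 2 * (obsLaw n σ θ).real B ≤ 1 ∧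
      ∀ y ∉ B, sqLoss (estimator r n σ lam) θ y
        ≤ ‖(LinearMap.ker (diffMap r n)).starProjection (y - θ)‖ ^ 2 := by
  have hlam0 : 0 ≤ lam := (Real.sqrt_nonneg _).trans hlam
  choose a ha hanorm using fun j => exists_diffMap_eq_single (n := n) hr j
  set K := LinearMap.ker (diffMap r n) with hK
  set μ := σ * (n : ℝ) ^ (r - 1) * lam with hμ
  -- Self-adjointness moves the projection from the residual onto `a j`, which does not increase its
  -- norm.
  set b : Fin (n - r) → EuclideanSpace ℝ (Fin n) := fun j => Kᗮ.starProjection (a j)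
  have hn0 : (0 : ℝ) < n := by exact_mod_cast hn
  have hn1 : (1 : ℝ) ≤ n := by exact_mod_cast hn
  have hPθ : K.starProjection θ = θ := Submodule.starProjection_eq_self_iff.2 hθ
  refine ⟨⋃ j, {y | μ < |inner ℝ (b j) (y - θ)|}, ?_, ?_, fun y hy => ?_⟩
  · exact MeasurableSet.iUnion fun j => measurableSet_lt (by fun_prop) (by fun_prop)
  · set L := Real.log (Real.exp 1 * n) with hL
    have hL0 : 0 ≤ L := Real.log_nonneg (by nlinarith [Real.add_one_le_exp 1])
    -- The constant 6 makes each tail `2 (e n)⁻³`; a union over at most `n` indices leaves `2 e⁻³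
    -- n⁻²`.
    have hj : ∀ j, (obsLaw n σ θ).real {y | μ < |inner ℝ (b j) (y - θ)|}
        ≤ 2 * Real.exp (-√(6 * L) ^ 2 / 2) := fun j => by
      refine obsLaw_real_abs_inner_gt_le n hσ θ (b j)
        ((Kᗮ.norm_starProjection_apply_le (a j)).trans (hanorm j)) (Real.sqrt_nonneg _) ?_
      have e : √(n : ℝ) * √(6 * L) = √(6 * n * L) := by
        rw [← Real.sqrt_mul hn0.le]
        ring_nf
      calc σ * ((n : ℝ) ^ (r - 1) * √n) * √(6 * L)
          = σ * (n : ℝ) ^ (r - 1) * √(6 * n * L) := by rw [← e]; ring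
        _ ≤ μ := by rw [hμ]; gcongr
    have hexp : Real.exp (-√(6 * L) ^ 2 / 2) = ((Real.exp 1 * n) ^ 3)⁻¹ := by
      rw [Real.sq_sqrt (by positivity), show -(6 * L) / 2 = -((3 : ℕ) * L) by push_cast; ring,
        Real.exp_neg, Real.exp_nat_mul, hL, Real.exp_log (by positivity)]
    have hsum : (obsLaw n σ θ).real (⋃ j, {y | μ < |inner ℝ (b j) (y - θ)|})
        ≤ n * (2 * ((Real.exp 1 * n) ^ 3)⁻¹) := by
      refine (measureReal_iUnion_fintype_le _).trans ?_
      refine (Finset.sum_le_sum fun j _ => hj j).trans ?_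
      rw [hexp, Finset.sum_const, Finset.card_univ, Fintype.card_fin, nsmul_eq_mul]
      gcongr
      exact_mod_cast Nat.sub_le n r
    refine (mul_le_mul_of_nonneg_left hsum (by positivity)).trans ?_
    have he : (2 : ℝ) ≤ Real.exp 1 := by linarith [Real.add_one_le_exp 1]
    have he3 : (2 : ℝ) ^ 3 ≤ Real.exp 1 ^ 3 := by gcongr
    have hE : (n : ℝ) ^ 2 * (n * (2 * ((Real.exp 1 * n) ^ 3)⁻¹)) = 2 / Real.exp 1 ^ 3 := by
      field_simp
    rw [hE, div_le_one (by positivity)]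
    linarith
  · simp only [Set.mem_iUnion, Set.mem_ofPred_eq, not_exists, not_lt] at hy
    have hest := estimator_eq_starProjection r n hσ hlam0 ha y fun j => by
      have e : y - K.starProjection y = Kᗮ.starProjection (y - θ) := by
        rw [Submodule.starProjection_orthogonal_val, map_sub, hPθ]
        abel
      rw [← hK, e, Submodule.inner_starProjection_left_eq_right, real_inner_comm]
      exact hy j
    rw [sqLoss, hest, map_sub, hPθ]

/-- On the exceptional event, `x² ≤ c x⁴ / 2 + c⁻¹ / 2` is applied to each noise coordinate, so no
independence between the event and the noise is needed. -/
theorem integral_sqLoss_estimator_le {r n : ℕ} (hr : 1 ≤ r) (hrn : r ≤ n) {σ lam : ℝ}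
    (hσ : 0 < σ) {θ : EuclideanSpace ℝ (Fin n)} (hθ : diffOp r θ.ofLp = 0)
    (hlam : √(6 * n * Real.log (Real.exp 1 * n)) ≤ lam) :
    ∫ y, sqLoss (estimator r n σ lam) θ y ∂(obsLaw n σ θ)
      ≤ (r * ∫ z, z ^ 2 ∂(gaussianReal 0 1) + (∫ z, z ^ 4 ∂(gaussianReal 0 1)) / 2 + 1 / 2)
        * σ ^ 2 := by
  have hn0 : (0 : ℝ) < n := by exact_mod_cast hr.trans hrn
  have hlam0 : 0 ≤ lam := (Real.sqrt_nonneg _).trans hlam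
  obtain ⟨B, hB, hBp, hBloss⟩ := exists_event_sqLoss_le hr (hr.trans hrn) hσ.le hθ hlam
  set K := LinearMap.ker (diffMap r n) with hK
  set e := EuclideanSpace.basisFun (Fin n) ℝ
  -- Balances the two costs: summed over `n` coordinates, the fourth moments contribute order `σ²`,
  -- and the constants contribute `σ² n² / 2` times a probability of at most `n⁻²`.
  set c := (σ ^ 2 * n)⁻¹ with hc
  have hc0 : 0 < c := by positivity
  obtain ⟨hPint, hPeq⟩ := integral_norm_starProjection_sq n σ θ K
  have h4int : Integrable (fun y => ∑ i, c / 2 * inner ℝ (e i) (y - θ) ^ 4) (obsLaw n σ θ) :=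
    integrable_finsetSum _ fun i _ => (integrable_inner_pow n σ θ _ 4).const_mul _
  have hBint : Integrable (B.indicator fun _ => (n : ℝ) * (c⁻¹ / 2)) (obsLaw n σ θ) :=
    (integrable_const _).indicator hB
  have hbound : ∀ y, sqLoss (estimator r n σ lam) θ y
      ≤ ‖K.starProjection (y - θ)‖ ^ 2 + ∑ i, c / 2 * inner ℝ (e i) (y - θ) ^ 4
        + B.indicator (fun _ => (n : ℝ) * (c⁻¹ / 2)) y := fun y => by
    by_cases hy : y ∈ B
    · rw [Set.indicator_of_mem hy]
      have h1 := sqLoss_estimator_le r n hσ.le hlam0 hθ y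
      rw [← e.sum_sq_inner_right] at h1
      have h2 : ∑ i, inner ℝ (e i) (y - θ) ^ 2
          ≤ ∑ i, (c / 2 * inner ℝ (e i) (y - θ) ^ 4 + c⁻¹ / 2) :=
        Finset.sum_le_sum fun i _ => by
          set x := inner ℝ (e i) (y - θ)
          have h3 : c / 2 * x ^ 4 + c⁻¹ / 2 - x ^ 2 = c / 2 * (x ^ 2 - c⁻¹) ^ 2 := by
            field_simp
            ring
          have h4 : 0 ≤ c / 2 * (x ^ 2 - c⁻¹) ^ 2 := by positivity
          linarith
      rw [Finset.sum_add_distrib, Finset.sum_const, Finset.card_univ, Fintype.card_fin,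
        nsmul_eq_mul] at h2
      linarith [sq_nonneg ‖K.starProjection (y - θ)‖]
    · rw [Set.indicator_of_notMem hy, add_zero]
      have h : 0 ≤ ∑ i, c / 2 * inner ℝ (e i) (y - θ) ^ 4 :=
        Finset.sum_nonneg fun i _ => by positivity
      linarith [hBloss y hy]
  refine (integral_mono (integrable_sqLoss_estimator r n hσ.le hlam0 hθ)
    ((hPint.add h4int).add hBint) hbound).trans ?_
  rw [integral_add' (hPint.add h4int) hBint, integral_add' hPint h4int, hPeq, hK, finrank_ker_diffMap hr hrn,
    integral_finsetSum _ fun i _ => (integrable_inner_pow n σ θ _ 4).const_mul _,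
    integral_indicator_const _ hB]
  simp_rw [integral_const_mul, integral_inner_pow n σ, e.orthonormal.1]
  rw [Finset.sum_const, Finset.card_univ, Fintype.card_fin, nsmul_eq_mul, smul_eq_mul]
  set M₂ := ∫ z, z ^ 2 ∂(gaussianReal 0 1)
  set M₄ := ∫ z, z ^ 4 ∂(gaussianReal 0 1)
  have e1 : (n : ℝ) * (c / 2 * ((σ * 1) ^ 4 * M₄)) = M₄ / 2 * σ ^ 2 := by
    rw [hc]
    field_simp
  have e2 : (obsLaw n σ θ).real B * (n * (c⁻¹ / 2))
      = σ ^ 2 / 2 * (n ^ 2 * (obsLaw n σ θ).real B) := by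
    rw [hc, inv_inv]
    ring
  rw [e1, e2]
  nlinarith [mul_le_mul_of_nonneg_left hBp (by positivity : 0 ≤ σ ^ 2 / 2)]

end TrendFilter

/-- If `D^{(r)} θstar = 0` and `lam ≥ √(6 n log (e n))`, the penalized trend filtering estimator
has (finite) risk at most `C_r σ² / n`, where `C_r` depends on `r` alone. -/
theorem lemma2p14 (r : ℕ) (hr : 1 ≤ r) :
    ∃ C : ℝ, 0 < C ∧
      ∀ (n : ℕ), 2 * r ≤ n →
      ∀ (σ : ℝ), 0 ≤ σ →
      ∀ (θstar : EuclideanSpace ℝ (Fin n)), TrendFilter.diffOp r θstar.ofLp = 0 →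
      ∀ (lam : ℝ), Real.sqrt (6 * n * Real.log (Real.exp 1 * n)) ≤ lam →
        Integrable (TrendFilter.sqLoss (TrendFilter.estimator r n σ lam) θstar)
            (TrendFilter.obsLaw n σ θstar) ∧
          TrendFilter.risk σ (TrendFilter.estimator r n σ lam) θstar ≤ C * σ ^ 2 / n := by
  have hM₂ : 0 ≤ ∫ z : ℝ, z ^ 2 ∂(gaussianReal 0 1) := integral_nonneg fun z => sq_nonneg z
  have hM₄ : 0 ≤ ∫ z : ℝ, z ^ 4 ∂(gaussianReal 0 1) := integral_nonneg fun z => by positivity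
  refine ⟨r * ∫ z, z ^ 2 ∂(gaussianReal 0 1) + (∫ z, z ^ 4 ∂(gaussianReal 0 1)) / 2 + 1 / 2,
    by positivity, fun n hn σ hσ θ hθ lam hlam => ?_⟩
  have hlam0 : 0 ≤ lam := (Real.sqrt_nonneg _).trans hlam
  have hint := TrendFilter.integrable_sqLoss_estimator r n hσ hlam0 hθ
  refine ⟨hint, ?_⟩
  rw [TrendFilter.risk, one_div_mul_eq_div]
  gcongr
  -- The weight `(σ² n)⁻¹` requires `σ > 0`; for `σ = 0` the noise, and hence the loss, has zero
  -- mean square.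
  rcases hσ.eq_or_lt with rfl | hσ0
  · refine (integral_mono hint (TrendFilter.integrable_norm_sub_sq n 0 θ)
      (TrendFilter.sqLoss_estimator_le r n le_rfl hlam0 hθ)).trans ?_
    rw [TrendFilter.integral_norm_sub_sq_zero]
    simp
  · exact TrendFilter.integral_sqLoss_estimator_le hr (by omega) hσ0 hθ hlam
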